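/- Let $K$ be a global function field, i.e. a finite extension of $\mathbb F_q(t)$ for some finite field $\mathbb F_q$. A prime $\mathfrak p$ of $K$ is identified with its normalized (surjective) discrete valuation $v_{\mathfrak p}\colon K\to\mathbb Z\cup\{\infty\}$; fix one prime of $K$ and denote it by $\infty$. For $P_1=[x_1:y_1]$ and $P_2=[x_2:y_2]$ in $\mathbb P^1(K)$ let $$\delta_{\mathfrak p}(P_1,P_2)=v_{\mathfrak p}(x_1y_2-x_2y_1)-\min\{v_{\mathfrak p}(x_1),v_{\mathfrak p}(y_1)\}-\min\{v_{\mathfrak p}(x_2),v_{\mathfrak p}(y_2)\}$$ be the $\mathfrak p$-adic logarithmic distance, which does not depend on the choice of homogeneous coordinates. Let $d\ge 0$ and let $\phi\colon\mathbb P^1\to\mathbb P^1$ be a rational map of degree $d$ defined over $K$, that is, $\phi=[F:G]$ with $F,G\in K[X,Y]$ relatively prime and homogeneous of degree $d$. Let $\mathcal P,\mathcal P'\subseteq\mathbb P^1(K)$ be subsets such that (a) for every prime $\mathfrak p\neq\infty$ of $K$, the quantity $\delta_{\mathfrak p}(P,Q)$, with $(P,Q)$ varying over the pairs of distinct points of $\mathcal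 P$, is constant; (b) $\mathcal P'\cup\phi(\mathcal P')\subseteq\mathcal P$. Then either $\#\mathcal P'\le 2d$, or after a change of coordinates $\phi$ is defined over a finite field: there are $\mu\in\mathrm{PGL}_2(K)$ and a finite subfield $k\subseteq K$ such that $\mu\circ\phi\circ\mu^{-1}=[F':G']$ with $F',G'\in k[X,Y]$ relatively prime and homogeneous of degree $d$. -/

import Mathlib

open MvPolynomial
open scoped LinearAlgebra.Projectivization RatFunc

noncomputable section

/-- A prime of a (global function) field `K`: a normalized discrete valuation
`v : K → ℤ ∪ {∞}`, i.e. an additive valuation that takes every value in `ℤ ∪ {∞}`.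
Distinct primes are distinct normalized valuations. -/
structure FieldPrime (K : Type*) [Field K] where
  /-- the normalized additive valuation -/
  v : AddValuation K (WithTop ℤ)
  surjective : Function.Surjective v

/-- The `𝔭`-adic logarithmic distance on `ℙ¹(K)`, for `P = [x₁ : y₁]`, `Q = [x₂ : y₂]`:
`v (x₁ y₂ - x₂ y₁) - min (v x₁) (v y₁) - min (v x₂) (v y₂)`.
It is independent of the coordinates, see `logDist_mk`; `logDist 𝔭 P P = ∞`. -/
def logDist {K : Type*} [Field K] (𝔭 : FieldPrime K) (P Q : ℙ K (Fin 2 → K)) : WithTop ℤ :=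
  𝔭.v (P.rep 0 * Q.rep 1 - Q.rep 0 * P.rep 1)
    - min (𝔭.v (P.rep 0)) (𝔭.v (P.rep 1)) - min (𝔭.v (Q.rep 0)) (𝔭.v (Q.rep 1))

theorem logDist_mk {K : Type*} [Field K] (𝔭 : FieldPrime K) (x y : Fin 2 → K)
    (hx : x ≠ 0) (hy : y ≠ 0) :
    logDist 𝔭 (Projectivization.mk K x hx) (Projectivization.mk K y hy) =
      𝔭.v (x 0 * y 1 - y 0 * x 1) - min (𝔭.v (x 0)) (𝔭.v (x 1))
        - min (𝔭.v (y 0)) (𝔭.v (y 1)) := by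
  obtain ⟨a, ha⟩ := Projectivization.exists_smul_eq_mk_rep K x hx
  obtain ⟨b, hb⟩ := Projectivization.exists_smul_eq_mk_rep K y hy
  have key : ∀ z : Fin 2 → K, z ≠ 0 → ∃ m : ℤ, min (𝔭.v (z 0)) (𝔭.v (z 1)) = (m : WithTop ℤ) := by
    intro z hz
    have : min (𝔭.v (z 0)) (𝔭.v (z 1)) ≠ ⊤ := by
      intro h
      rw [min_eq_top, AddValuation.top_iff, AddValuation.top_iff] at h
      exact hz (by ext i; fin_cases i <;> simp [h.1, h.2])
    exact ⟨_, (WithTop.coe_untop _ this).symm⟩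
  have hu : ∀ u : Kˣ, ∃ m : ℤ, 𝔭.v (u : K) = (m : WithTop ℤ) := fun u =>
    ⟨_, (WithTop.coe_untop _ ((AddValuation.ne_top_iff _).2 u.ne_zero)).symm⟩
  obtain ⟨m, hm⟩ := key x hx
  obtain ⟨n, hn⟩ := key y hy
  obtain ⟨r, hr⟩ := hu a
  obtain ⟨s, hs⟩ := hu b
  unfold logDist
  rw [← ha, ← hb]
  have e : (a • x) 0 * (b • y) 1 - (b • y) 0 * (a • x) 1
      = (a : K) * (b : K) * (x 0 * y 1 - y 0 * x 1) := by
    simp only [Pi.smul_apply, Units.smul_def, smul_eq_mul]; ring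
  have e1 : min (𝔭.v ((a • x) 0)) (𝔭.v ((a • x) 1)) = ((r + m : ℤ) : WithTop ℤ) := by
    simp only [Pi.smul_apply, Units.smul_def, smul_eq_mul, AddValuation.map_mul, hr]
    rw [min_add_add_left, hm, WithTop.coe_add]
  have e2 : min (𝔭.v ((b • y) 0)) (𝔭.v ((b • y) 1)) = ((s + n : ℤ) : WithTop ℤ) := by
    simp only [Pi.smul_apply, Units.smul_def, smul_eq_mul, AddValuation.map_mul, hs]
    rw [min_add_add_left, hn, WithTop.coe_add]
  rw [e, e1, e2, hm, hn, AddValuation.map_mul, AddValuation.map_mul, hr, hs]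
  cases h : 𝔭.v (x 0 * y 1 - y 0 * x 1) with
  | top => rfl
  | coe t =>
    norm_cast
    ring_nf

/-- A rational map `ℙ¹ → ℙ¹` of degree `d` defined over `K`, written as `[F : G]` with
`F, G ∈ K[X, Y]` relatively prime and homogeneous of degree `d`. (The pair is determined by the
map up to a common nonzero scalar.) -/
structure RationalMap (K : Type*) [Field K] (d : ℕ) where
  /-- first coordinate -/
  F : MvPolynomial (Fin 2) K
  /-- second coordinate -/
  G : MvPolynomial (Fin 2) K
  homF : F.IsHomogeneous d
  homG : G.IsHomogeneous d
  relPrime : IsRelPrime F G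

/-- The linear form `A i 0 * X + A i 1 * Y` given by the `i`-th row of `A`. -/
def linForm {K : Type*} [Field K] (A : Matrix (Fin 2) (Fin 2) K) (i : Fin 2) :
    MvPolynomial (Fin 2) K := C (A i 0) * X 0 + C (A i 1) * X 1

/-- The substitution `H(X, Y) ↦ H(a X + b Y, c X + d Y)` attached to a `2 × 2` matrix. -/
def linSubst {K : Type*} [Field K] (A : Matrix (Fin 2) (Fin 2) K) :
    MvPolynomial (Fin 2) K →ₐ[K] MvPolynomial (Fin 2) K := aeval (linForm A)

theorem linSubst_linSubst {K : Type*} [Field K] (A B : Matrix (Fin 2) (Fin 2) K)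
    (H : MvPolynomial (Fin 2) K) : linSubst A (linSubst B H) = linSubst (B * A) H := by
  have : (linSubst A).comp (linSubst B) = linSubst (B * A) := by
    apply MvPolynomial.algHom_ext
    intro i
    simp only [linSubst, AlgHom.comp_apply, aeval_X, linForm, map_add, map_mul,
      Matrix.mul_apply, Fin.sum_univ_two, MvPolynomial.algHom_C, MvPolynomial.algebraMap_eq]
    ring
  exact DFunLike.congr_fun this H

theorem linSubst_one {K : Type*} [Field K] (H : MvPolynomial (Fin 2) K) :
    linSubst (1 : Matrix (Fin 2) (Fin 2) K) H = H := by
  have : linSubst (1 : Matrix (Fin 2) (Fin 2) K) = AlgHom.id K _ := by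
    apply MvPolynomial.algHom_ext
    intro i
    fin_cases i <;> simp [linSubst, linForm]
  rw [this]; rfl

theorem linSubst_isHomogeneous {K : Type*} [Field K] (A : Matrix (Fin 2) (Fin 2) K) {d : ℕ}
    {H : MvPolynomial (Fin 2) K} (hH : H.IsHomogeneous d) : (linSubst A H).IsHomogeneous d := by
  have h1 : ∀ i, (linForm A i).IsHomogeneous 1 := fun i =>
    (isHomogeneous_C_mul_X _ _).add (isHomogeneous_C_mul_X _ _)
  have := hH.aeval (linForm A) h1
  rwa [one_mul] at this

namespace RationalMap

theorem eval_ne_zero {K : Type*} [Field K] {d : ℕ} (φ : RationalMap K d) {x : Fin 2 → K}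
    (hx : x ≠ 0) : ![eval x φ.F, eval x φ.G] ≠ 0 := by
  intro h
  have hF : eval x φ.F = 0 := by simpa using congrFun h 0
  have hG : eval x φ.G = 0 := by simpa using congrFun h 1
  obtain ⟨c, hc⟩ : ∃ c : Fin 2 → K, c 0 * x 0 + c 1 * x 1 = 1 := by
    by_cases h0 : x 0 = 0
    · have h1 : x 1 ≠ 0 := fun h1 => hx (by ext i; fin_cases i <;> simp [h0, h1])
      exact ⟨![0, (x 1)⁻¹], by simp [h1]⟩
    · exact ⟨![(x 0)⁻¹, 0], by simp [h0]⟩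
  set L : MvPolynomial (Fin 2) K := C (x 1) * X 0 - C (x 0) * X 1 with hL
  set Z : MvPolynomial (Fin 2) K := C (c 0) * X 0 + C (c 1) * X 1 with hZ
  have hcC : (C (c 0) * C (x 0) + C (c 1) * C (x 1) : MvPolynomial (Fin 2) K) = 1 := by
    rw [← C_mul, ← C_mul, ← C_add, hc, C_1]
  have hmod : ∀ i, L ∣ X i - C (x i) * Z := by
    intro i
    fin_cases i
    · exact ⟨C (c 1), by simp only [hL, hZ, Fin.zero_eta]; linear_combination (- X 0) * hcC⟩
    · exact ⟨- C (c 0), by simp only [hL, hZ, Fin.mk_one]; linear_combination (- X 1) * hcC⟩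
  have hdvd : ∀ H : MvPolynomial (Fin 2) K, H.IsHomogeneous d → eval x H = 0 → L ∣ H := by
    intro H hH h0
    let I := Ideal.span {L}
    have hcomp : (Ideal.Quotient.mkₐ K I)
        = (Ideal.Quotient.mkₐ K I).comp (aeval fun i => C (x i) * Z) := by
      apply MvPolynomial.algHom_ext
      intro i
      simp only [AlgHom.comp_apply, aeval_X, Ideal.Quotient.mkₐ_eq_mk]
      exact Ideal.Quotient.eq.2 (Ideal.mem_span_singleton.2 (hmod i))
    have hz : aeval (fun i => C (x i) * Z) H = 0 := by
      have : aeval (fun i => C (x i) * Z) H = C (eval x H) * Z ^ d := by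
        rw [aeval_def, eval₂_eq, eval_eq, map_sum, Finset.sum_mul]
        refine Finset.sum_congr rfl fun m hm => ?_
        have hdeg : m.degree = d := by
          by_contra hne
          exact mem_support_iff.1 hm (hH.coeff_eq_zero hne)
        have hprod : (∏ i ∈ m.support, Z ^ m i) = Z ^ d := by
          rw [Finset.prod_pow_eq_pow_sum, ← hdeg]; rfl
        simp only [mul_pow, Finset.prod_mul_distrib, hprod, map_mul, map_prod, map_pow,
          MvPolynomial.algebraMap_eq]
        ring
      rw [this, h0, C_0, zero_mul]
    have := DFunLike.congr_fun hcomp H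
    rw [AlgHom.comp_apply, hz, map_zero, Ideal.Quotient.mkₐ_eq_mk,
      Ideal.Quotient.eq_zero_iff_mem, Ideal.mem_span_singleton] at this
    exact this
  have hunit := φ.relPrime (hdvd _ φ.homF hF) (hdvd _ φ.homG hG)
  have h0 : eval x L = 0 := by simp [hL]; ring
  exact (hunit.map (eval x)).ne_zero h0

/-- The map `[x : y] ↦ [F(x, y) : G(x, y)]` on `ℙ¹(K)`. -/
def toFun {K : Type*} [Field K] {d : ℕ} (φ : RationalMap K d) (P : ℙ K (Fin 2 → K)) :
    ℙ K (Fin 2 → K) :=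
  Projectivization.mk K ![eval P.rep φ.F, eval P.rep φ.G] (φ.eval_ne_zero P.rep_nonzero)

theorem toFun_mk {K : Type*} [Field K] {d : ℕ} (φ : RationalMap K d) (x : Fin 2 → K)
    (hx : x ≠ 0) : φ.toFun (Projectivization.mk K x hx) =
      Projectivization.mk K ![eval x φ.F, eval x φ.G] (φ.eval_ne_zero hx) := by
  obtain ⟨a, ha⟩ := Projectivization.exists_smul_eq_mk_rep K x hx
  have hom : ∀ H : MvPolynomial (Fin 2) K, H.IsHomogeneous d →
      eval (a • x) H = (a : K) ^ d * eval x H := fun H hH => by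
    rw [eval_eq, eval_eq, Finset.mul_sum]
    refine Finset.sum_congr rfl fun m hm => ?_
    have hdeg : m.degree = d := by
      by_contra hne
      exact mem_support_iff.1 hm (hH.coeff_eq_zero hne)
    have hprod : (∏ i ∈ m.support, (a : K) ^ m i) = (a : K) ^ d := by
      rw [Finset.prod_pow_eq_pow_sum, ← hdeg]; rfl
    simp only [Pi.smul_apply, Units.smul_def, smul_eq_mul, mul_pow, Finset.prod_mul_distrib, hprod]
    ring
  unfold toFun
  rw [Projectivization.mk_eq_mk_iff]
  refine ⟨a ^ d, ?_⟩
  rw [← ha]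
  ext i
  fin_cases i
  · exact (hom _ φ.homF).symm
  · exact (hom _ φ.homG).symm

/-- The conjugate `μ ∘ φ ∘ μ⁻¹` of `φ` by the Möbius transformation
`μ = [a X + b Y : c X + d Y]`, where `a, b, c, d` are the entries of the matrix `μ`. -/
def conj {K : Type*} [Field K] {d : ℕ} (φ : RationalMap K d) (μ : GL (Fin 2) K) :
    RationalMap K d where
  F := C (μ.1 0 0) * linSubst μ⁻¹.1 φ.F + C (μ.1 0 1) * linSubst μ⁻¹.1 φ.G
  G := C (μ.1 1 0) * linSubst μ⁻¹.1 φ.F + C (μ.1 1 1) * linSubst μ⁻¹.1 φ.G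
  homF := ((linSubst_isHomogeneous _ φ.homF).C_mul _).add
    ((linSubst_isHomogeneous _ φ.homG).C_mul _)
  homG := ((linSubst_isHomogeneous _ φ.homF).C_mul _).add
    ((linSubst_isHomogeneous _ φ.homG).C_mul _)
  relPrime := by
    intro D h1 h2
    set f := linSubst μ⁻¹.1 φ.F
    set g := linSubst μ⁻¹.1 φ.G
    have hinv : μ⁻¹.1 * μ.1 = 1 := μ.inv_val
    have hinv2 : μ.1 * μ⁻¹.1 = 1 := μ.val_inv
    have ent : ∀ i j, (C (μ⁻¹.1 i 0) * C (μ.1 0 j) + C (μ⁻¹.1 i 1) * C (μ.1 1 j) :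
        MvPolynomial (Fin 2) K) = C ((1 : Matrix (Fin 2) (Fin 2) K) i j) := by
      intro i j
      rw [← hinv, Matrix.mul_apply, Fin.sum_univ_two, C_add, C_mul, C_mul]
    have hf : D ∣ f := by
      have := dvd_add (h1.mul_left (C (μ⁻¹.1 0 0))) (h2.mul_left (C (μ⁻¹.1 0 1)))
      convert this using 1
      have e0 := ent 0 0
      have e1 := ent 0 1
      simp only [Matrix.one_apply_eq, Matrix.one_apply_ne (show (0 : Fin 2) ≠ 1 by decide),
        C_1, C_0] at e0 e1
      linear_combination (-f) * e0 + (-g) * e1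
    have hg : D ∣ g := by
      have := dvd_add (h1.mul_left (C (μ⁻¹.1 1 0))) (h2.mul_left (C (μ⁻¹.1 1 1)))
      convert this using 1
      have e0 := ent 1 0
      have e1 := ent 1 1
      simp only [Matrix.one_apply_eq, Matrix.one_apply_ne (show (1 : Fin 2) ≠ 0 by decide),
        C_1, C_0] at e0 e1
      linear_combination (-f) * e0 + (-g) * e1
    have back : ∀ H, linSubst μ.1 (linSubst μ⁻¹.1 H) = H := fun H => by
      rw [linSubst_linSubst, hinv, linSubst_one]
    have forth : linSubst μ⁻¹.1 (linSubst μ.1 D) = D := by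
      rw [linSubst_linSubst, hinv2, linSubst_one]
    have hu : IsUnit (linSubst μ.1 D) := φ.relPrime
      (by simpa only [f, back] using map_dvd (linSubst μ.1) hf)
      (by simpa only [g, back] using map_dvd (linSubst μ.1) hg)
    rw [← forth]
    exact hu.map (linSubst μ⁻¹.1)

/-- `φ` is defined over the subfield `k` of `K`: after multiplying `F` and `G` by a common
nonzero scalar, all their coefficients lie in `k`. -/
def IsDefinedOver {K : Type*} [Field K] {d : ℕ} (φ : RationalMap K d) (k : Subfield K) : Prop :=
  ∃ c : K, c ≠ 0 ∧ ∀ m, c * coeff m φ.F ∈ k ∧ c * coeff m φ.G ∈ k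

end RationalMap

end

/-! Constant logarithmic distance at `𝔭` forces cross-ratios of points of `A` to have `𝔭`-adic
valuation zero, because the normalizing minima cancel. A transcendental element of `K` has a zero,
and so does its inverse; these are different primes, so one of them is not `infty`. Hence the
cross-ratios are algebraic over `Fq` (`FieldPrime.isAlgebraic_of_forall_eq_zero`). Moving three
points of `A` to `[1:0]`, `[0:1]`, `[1:1]` makes the coordinates of all points of `A` algebraic
(`exists_algebraic_coordinates`).

If `A'` has more than `2d` points, then `2d + 1` of them and their images have coordinates in one
finite field `k`. Apply a `k`-linear functional `K → k` to the coefficients of the conjugated map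
`[F : G]`. The resulting pair `F', G'` gives the same values at these points, so the form `F G' - F'
G` of degree `2d` has `2d + 1` zeros and vanishes. Coprimality gives `[F' : G'] = [F : G]`
(`RationalMap.isDefinedOver_of_card_lt`). -/

/-! ### Function fields over their constants -/

theorem finiteDimensional_adjoin_of_transcendental {F K : Type*} [Field F] [Field K] [Algebra F K]
    [Algebra.EssFiniteType F K] (h1 : Algebra.trdeg F K ≤ 1) {x : K} (hx : Transcendental F x) :
    FiniteDimensional (IntermediateField.adjoin F {x}) K := by
  have hind : AlgebraicIndependent F (fun _ : Unit => x) :=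
    (algebraicIndependent_unique_type_iff).2 hx
  -- One independent element already exhausts the transcendence degree, so `K` is algebraic over
  -- `F(x)`; being essentially of finite type, it is then finite.
  have hb : IsTranscendenceBasis F (fun _ : Unit => x) :=
    hind.isTranscendenceBasis_of_lift_trdeg_le_of_finite (by simpa using h1)
  have halg := hb.isAlgebraic_field
  rw [Set.range_const] at halg
  have : Algebra.EssFiniteType (IntermediateField.adjoin F {x}) K :=
    Algebra.EssFiniteType.of_comp F _ _
  exact Algebra.finite_of_essFiniteType_of_isAlgebraic

theorem FunctionField.trdeg_le_one (F K : Type*) [Field F] [Field K] [Algebra F⟮X⟯ K]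
    [FunctionField F K] [Algebra F K] [IsScalarTower F F⟮X⟯ K] : Algebra.trdeg F K ≤ 1 := by
  have : Algebra.IsAlgebraic (Polynomial F) F⟮X⟯ :=
    IsLocalization.isAlgebraic _ (nonZeroDivisors (Polynomial F))
  have h1 := (IsTranscendenceBasis.polynomial Unit F).algebraMap_comp (A := F⟮X⟯)
  have h2 := (h1.algebraMap_comp (A := K)).lift_cardinalMk_eq_trdeg
  simpa using h2.ge

theorem FunctionField.essFiniteType (F K : Type*) [Field F] [Field K] [Algebra F⟮X⟯ K]
    [FunctionField F K] [Algebra F K] [IsScalarTower F F⟮X⟯ K] : Algebra.EssFiniteType F K := by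
  have : Algebra.EssFiniteType (Polynomial F) F⟮X⟯ :=
    Algebra.EssFiniteType.of_isLocalization _ (nonZeroDivisors (Polynomial F))
  have : Algebra.EssFiniteType F F⟮X⟯ := Algebra.EssFiniteType.comp F (Polynomial F) F⟮X⟯
  exact Algebra.EssFiniteType.comp F F⟮X⟯ K

/-! ### Discrete valuations and zeros of transcendental elements -/

/-- A valuation whose nonzero values are the powers of an element `g > 1` comes from a prime. -/
theorem FieldPrime.exists_of_zpow {K Γ₀ : Type*} [Field K] [LinearOrderedCommGroupWithZero Γ₀]
    (v : Valuation K Γ₀) {g : Γ₀} (hg : 1 < g) (hgv : ∃ z, v z = g)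
    (h : ∀ y, y ≠ 0 → ∃ n : ℤ, v y = g ^ n) :
    ∃ 𝔭 : FieldPrime K, ∀ y, v y < 1 → 0 < 𝔭.v y := by
  classical
  have g0 : g ≠ 0 := (zero_lt_one.trans hg).ne'
  -- The sign passes from multiplicative to additive valuations. Nothing is required at `0`, which
  -- `f` sends to `⊤`.
  have h' : ∀ y, ∃ n : ℤ, y ≠ 0 → v y = g ^ (-n) := fun y => by
    by_cases hy : y = 0
    · exact ⟨0, fun h => absurd hy h⟩
    · obtain ⟨n, hn⟩ := h y hy
      exact ⟨-n, fun _ => by rw [neg_neg, hn]⟩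
  choose e he using h'
  have inj : ∀ m n : ℤ, g ^ (-m) = g ^ (-n) → m = n := fun m n hmn => by
    have := zpow_right_injective₀ (zero_lt_one.trans hg) hg.ne' hmn
    omega
  let f : K → WithTop ℤ := fun y => if y = 0 then ⊤ else (e y : WithTop ℤ)
  have f0 : f 0 = ⊤ := if_pos rfl
  have fe : ∀ y, y ≠ 0 → f y = (e y : WithTop ℤ) := fun y hy => if_neg hy
  have fle : ∀ a b, f a ≤ f b ↔ v b ≤ v a := by
    intro a b
    by_cases hb : b = 0
    · simp [hb, f0]
    by_cases ha : a = 0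
    · subst ha
      rw [f0, fe b hb, map_zero, le_zero_iff, Valuation.zero_iff]
      simp [hb]
    rw [fe a ha, fe b hb, he a ha, he b hb, zpow_le_zpow_iff_right₀ hg, WithTop.coe_le_coe]
    omega
  let w : AddValuation K (WithTop ℤ) := AddValuation.of f f0
    (by
      rw [fe 1 one_ne_zero, ← WithTop.coe_zero, WithTop.coe_inj]
      exact inj _ _ (by rw [← he 1 one_ne_zero]; simp))
    (fun a b => by
      rw [min_le_iff, fle, fle]
      rcases le_total (v a) (v b) with hab | hab
      · exact Or.inr ((v.map_add a b).trans (max_le hab le_rfl))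
      · exact Or.inl ((v.map_add a b).trans (max_le le_rfl hab)))
    (fun a b => by
      by_cases ha : a = 0
      · simp [ha, f0]
      by_cases hb : b = 0
      · simp [hb, f0]
      rw [fe a ha, fe b hb, fe _ (mul_ne_zero ha hb), ← WithTop.coe_add, WithTop.coe_inj]
      exact inj _ _ (by
        rw [← he _ (mul_ne_zero ha hb), map_mul, he a ha, he b hb, neg_add, zpow_add₀ g0]))
  refine ⟨⟨w, fun n => ?_⟩, fun y hy => ?_⟩
  · cases n with
    | top => exact ⟨0, f0⟩
    | coe n =>
      obtain ⟨z, hz⟩ := hgv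
      have hz0 : z ≠ 0 := fun h => by rw [h, map_zero] at hz; exact g0 hz.symm
      refine ⟨z ^ (-n), (fe _ (zpow_ne_zero _ hz0)).trans (WithTop.coe_inj.2 (inj _ _ ?_))⟩
      rw [← he _ (zpow_ne_zero _ hz0), map_zpow₀, hz]
  · have : ¬ f y ≤ f 1 := fun hle => by
      rw [fle, map_one] at hle
      exact hy.not_ge hle
    have h1 : f 1 = 0 := w.map_one
    rw [h1, not_le] at this
    exact this

/-- In a vanishing sum whose terms are not all zero, two terms have equal valuation. -/
theorem Valuation.exists_eq_of_sum_eq_zero {K Γ₀ ι : Type*} [Field K]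
    [LinearOrderedCommGroupWithZero Γ₀] (v : Valuation K Γ₀) {s : Finset ι} {f : ι → K}
    (h0 : ∑ i ∈ s, f i = 0) (hne : ∃ i ∈ s, f i ≠ 0) :
    ∃ i ∈ s, ∃ j ∈ s, i ≠ j ∧ f i ≠ 0 ∧ v (f i) = v (f j) := by
  classical
  obtain ⟨i, hi, hfi⟩ := hne
  -- A term of strictly largest valuation would give its own nonzero valuation to the sum.
  obtain ⟨m, hm, hmax⟩ := s.exists_max_image (fun i => v (f i)) ⟨i, hi⟩
  have hfm : f m ≠ 0 := fun h => by
    have := hmax i hi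
    rw [h, map_zero, le_zero_iff, Valuation.zero_iff] at this
    exact hfi this
  by_contra! hcon
  have := v.map_sum_eq_of_lt hm (fun i hi => by
    rw [Finset.mem_sdiff, Finset.mem_singleton] at hi
    exact lt_of_le_of_ne (hmax i hi.1) fun h => hcon m hm i hi.1 (Ne.symm hi.2) hfm h.symm)
  rw [h0, map_zero] at this
  exact hfm ((Valuation.zero_iff v).1 this.symm)

/-- If every nonzero element of a subfield of finite index has a power of `u` as valuation, then
a fixed power of every nonzero valuation is a power of `u`. -/
theorem Valuation.exists_pow_factorial_eq {E K Γ₀ : Type*} [Field E] [Field K] [Algebra E K]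
    [FiniteDimensional E K] [LinearOrderedCommGroupWithZero Γ₀] (v : Valuation K Γ₀) {u : Γ₀}
    (hu : u ≠ 0) (hE : ∀ a : E, a ≠ 0 → ∃ n : ℤ, v (algebraMap E K a) = u ^ n) {y : K}
    (hy : y ≠ 0) : ∃ n : ℤ, v y ^ (Module.finrank E K).factorial = u ^ n := by
  set p := minpoly E y
  have hp : p ≠ 0 := minpoly.ne_zero (Algebra.IsIntegral.isIntegral y)
  have hsum : ∑ i ∈ Finset.range (p.natDegree + 1), algebraMap E K (p.coeff i) * y ^ i = 0 := by
    have := minpoly.aeval E y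
    rw [Polynomial.aeval_eq_sum_range] at this
    simpa only [Algebra.smul_def] using this
  have hvy : v y ≠ 0 := (Valuation.ne_zero_iff v).2 hy
  -- Equal valuations of two terms of the minimal equation make `v y ^ (j - i)` a power of `u`. As
  -- `j - i` is at most the field degree, the factorial is an exponent that serves every `y`.
  have key : ∀ i j, i < j → j ≤ p.natDegree → algebraMap E K (p.coeff i) * y ^ i ≠ 0 →
      v (algebraMap E K (p.coeff i) * y ^ i) = v (algebraMap E K (p.coeff j) * y ^ j) →
      ∃ n : ℤ, v y ^ (Module.finrank E K).factorial = u ^ n := by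
    intro i j hij hj hi0 heq
    have hj0 : algebraMap E K (p.coeff j) * y ^ j ≠ 0 := by
      rwa [← Valuation.ne_zero_iff v, ← heq, Valuation.ne_zero_iff]
    obtain ⟨m, hm⟩ := hE (p.coeff i) (fun h => hi0 (by simp [h]))
    obtain ⟨n, hn⟩ := hE (p.coeff j) (fun h => hj0 (by simp [h]))
    obtain ⟨c, rfl⟩ : ∃ c, j = i + c := ⟨j - i, by omega⟩
    have hc : v y ^ c = u ^ (m - n) := by
      rw [map_mul, map_mul, map_pow, map_pow, hm, hn, pow_add] at heq
      rw [zpow_sub₀ hu, eq_div_iff (zpow_ne_zero _ hu)]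
      apply mul_left_cancel₀ (pow_ne_zero i hvy)
      rw [mul_comm (v y ^ i) (u ^ m), heq, ← mul_assoc, mul_comm]
    have hle : p.natDegree ≤ Module.finrank E K := minpoly.natDegree_le y
    obtain ⟨b, hb⟩ := Nat.dvd_factorial (show 0 < c by omega)
      (show c ≤ Module.finrank E K by omega)
    exact ⟨(m - n) * b, by rw [hb, pow_mul, hc, zpow_mul, zpow_natCast]⟩
  obtain ⟨i, hi, j, hj, hij, hi0, heq⟩ := v.exists_eq_of_sum_eq_zero hsum
    ⟨p.natDegree, by simp, mul_ne_zero (by simpa using hp) (pow_ne_zero _ hy)⟩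
  rw [Finset.mem_range] at hi hj
  rcases lt_or_gt_of_ne hij with h | h
  · exact key i j h (by omega) hi0 heq
  · refine key j i h (by omega) ?_ heq.symm
    rwa [← Valuation.ne_zero_iff v, ← heq, Valuation.ne_zero_iff]

/-- A valuation trivial on `F` takes on `F(x)` only powers of `v x`, if `0 < v x < 1`. -/
theorem Valuation.exists_zpow_of_mem_adjoin {F K Γ₀ : Type*} [Field F] [Field K] [Algebra F K]
    [LinearOrderedCommGroupWithZero Γ₀] (v : Valuation K Γ₀)
    (hF : ∀ a : F, a ≠ 0 → v (algebraMap F K a) = 1) {x : K} (hx0 : x ≠ 0) (hx : v x < 1)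
    (a : IntermediateField.adjoin F {x}) (ha : a ≠ 0) :
    ∃ n : ℤ, v (algebraMap _ K a) = v x ^ n := by
  have hvx : v x ≠ 0 := (Valuation.ne_zero_iff v).2 hx0
  have poly : ∀ p : Polynomial F, p ≠ 0 → ∃ n : ℤ, v (Polynomial.aeval x p) = v x ^ n := by
    intro p hp
    have hle : ∀ q : Polynomial F, v (Polynomial.aeval x q) ≤ 1 := fun q => by
      rw [Polynomial.aeval_eq_sum_range]
      refine v.map_sum_le fun i _ => ?_
      rw [Algebra.smul_def, map_mul, map_pow]
      refine mul_le_one' ?_ (pow_le_one' hx.le i)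
      by_cases h : q.coeff i = 0
      · simp [h]
      · rw [hF _ h]
    -- Write `p = X ^ n * q` with `q(0) ≠ 0`: the constant term dominates in `q(x)`, so `v (q(x)) =
    -- 1`.
    obtain ⟨q, hq, hq0⟩ := Polynomial.exists_eq_pow_rootMultiplicity_mul_and_not_dvd p hp 0
    rw [Polynomial.C_0, sub_zero] at hq hq0
    rw [Polynomial.X_dvd_iff] at hq0
    refine ⟨(p.rootMultiplicity 0 : ℕ), ?_⟩
    have h1 : v (Polynomial.aeval x q) = 1 := by
      rw [← Polynomial.divX_mul_X_add q, map_add, map_mul, Polynomial.aeval_X, Polynomial.aeval_C,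
        ← hF _ hq0]
      apply Valuation.map_add_eq_of_lt_right
      rw [hF _ hq0, map_mul]
      exact (mul_le_of_le_one_left' (hle _)).trans_lt hx
    have h2 := congrArg (fun q => v (Polynomial.aeval x q)) hq
    rwa [map_mul, map_mul, map_pow, map_pow, Polynomial.aeval_X, h1, mul_one,
      ← zpow_natCast] at h2
  obtain ⟨r, s, hrs⟩ := (IntermediateField.mem_adjoin_simple_iff F (a : K)).1 a.2
  have ha' : (a : K) ≠ 0 := by simpa using ha
  have hr : r ≠ 0 := by rintro rfl; simp at hrs; exact ha hrs
  have hs : s ≠ 0 := by rintro rfl; simp at hrs; exact ha hrs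
  obtain ⟨m, hm⟩ := poly r hr
  obtain ⟨n, hn⟩ := poly s hs
  refine ⟨m - n, ?_⟩
  rw [IntermediateField.algebraMap_apply, hrs, map_div₀, hm, hn, zpow_sub₀ hvx]

/-- A nontrivial totally ordered group some power map of which lands in a cyclic subgroup is
generated by an element greater than `1`. -/
theorem exists_one_lt_forall_zpow {G : Type*} [CommGroup G] [LinearOrder G] [IsOrderedMonoid G]
    {u : G} (hu : u < 1) {N : ℕ} (hN : N ≠ 0) (h : ∀ y : G, ∃ n : ℤ, y ^ N = u ^ n) :
    ∃ g : G, 1 < g ∧ ∀ y : G, ∃ n : ℤ, y = g ^ n := by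
  -- Ordered groups are torsion-free, so `y ↦ y ^ N` embeds `G` into a cyclic group.
  let f : G →* Subgroup.zpowers u := (powMonoidHom N).codRestrict _ fun y => by
    obtain ⟨n, hn⟩ := h y
    exact ⟨n, hn.symm⟩
  have hf : Function.Injective f := fun a b hab =>
    pow_left_injective hN (congrArg Subtype.val hab)
  have := isCyclic_of_injective f hf
  obtain ⟨g, hg⟩ := IsCyclic.exists_generator (α := G)
  rcases lt_trichotomy 1 g with h1 | h1 | h1
  · exact ⟨g, h1, fun y => (hg y).imp fun n hn => hn.symm⟩
  · obtain ⟨n, hn⟩ := hg u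
    rw [← h1] at hn
    simp only [one_zpow] at hn
    exact absurd hn.symm hu.ne
  · refine ⟨g⁻¹, one_lt_inv'.2 h1, fun y => ?_⟩
    obtain ⟨n, hn⟩ := hg y
    exact ⟨-n, by rw [← hn]; simp⟩

/-- A transcendental element of a function field over a finite field has a zero. -/
theorem FieldPrime.exists_pos_of_transcendental {F K : Type*} [Field F] [Finite F] [Field K]
    [Algebra F K] [Algebra.EssFiniteType F K] (h1 : Algebra.trdeg F K ≤ 1) {x : K}
    (hx : Transcendental F x) : ∃ 𝔭 : FieldPrime K, 0 < 𝔭.v x := by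
  have hx0 : x ≠ 0 := fun h => hx (h ▸ isAlgebraic_zero)
  let R := (Algebra.adjoin F {x}).toSubring
  let xR : R := ⟨x, Algebra.self_mem_adjoin_singleton F x⟩
  -- An inverse `p(x)` of `x` in `F[x]` would make `x` a root of `X * p - 1`, which is nonzero at
  -- `0`.
  have hI : Ideal.span {xR} ≠ ⊤ := by
    rw [Ne, Ideal.span_singleton_eq_top, isUnit_iff_exists_inv]
    rintro ⟨⟨b, hb⟩, hxb⟩
    have hxb' : x * b = 1 := congrArg Subtype.val hxb
    replace hb : b ∈ Algebra.adjoin F {x} := hb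
    rw [Algebra.adjoin_singleton_eq_range_aeval] at hb
    obtain ⟨p, rfl⟩ := hb
    refine hx ⟨Polynomial.X * p - 1, fun h => ?_, ?_⟩
    · simpa using congrArg (Polynomial.eval 0) h
    · simpa [sub_eq_zero] using hxb'
  -- The value group of `V` is a priori arbitrary; finiteness of `K` over `F(x)` is what makes it
  -- infinite cyclic.
  obtain ⟨V, -, hV⟩ := Ideal.image_subset_nonunits_valuationSubring _ hI
  have hvx : V.valuation x < 1 :=
    (V.mem_nonunits_iff).1 (hV ⟨xR, Ideal.subset_span rfl, rfl⟩)
  -- Nonzero constants are roots of unity, and an ordered value group has no torsion.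
  have hF : ∀ a : F, a ≠ 0 → V.valuation (algebraMap F K a) = 1 := fun a ha => by
    have hfin : IsOfFinOrder (Units.mk0 a ha) := isOfFinOrder_of_finite _
    obtain ⟨n, hn, hpow⟩ := hfin.exists_pow_eq_one
    have h2 : V.valuation (algebraMap F K a) ^ n = 1 := by
      rw [← map_pow, ← map_pow, show a ^ n = 1 from congrArg Units.val hpow, map_one, map_one]
    exact (pow_eq_one_iff.1 h2).resolve_right hn.ne'
  have := finiteDimensional_adjoin_of_transcendental h1 hx
  have hne : V.valuation x ≠ 0 := (Valuation.ne_zero_iff _).2 hx0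
  have hval : ∀ y : V.ValueGroupˣ, ∃ n : ℤ,
      y ^ (Module.finrank (IntermediateField.adjoin F {x}) K).factorial
        = (Units.mk0 (V.valuation x) hne) ^ n := fun y => by
    obtain ⟨z, hz⟩ := V.valuation_surjective y
    have hz0 : z ≠ 0 := by rintro rfl; rw [map_zero] at hz; exact y.ne_zero hz.symm
    obtain ⟨n, hn⟩ := V.valuation.exists_pow_factorial_eq hne
      (V.valuation.exists_zpow_of_mem_adjoin hF hx0 hvx) hz0
    exact ⟨n, Units.ext (by rw [Units.val_pow_eq_pow_val, Units.val_zpow_eq_zpow_val, ← hz, hn]; rfl)⟩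
  obtain ⟨g, hg, hgen⟩ := exists_one_lt_forall_zpow (u := Units.mk0 (V.valuation x) hne)
    (by rwa [← Units.val_lt_val]) (Nat.factorial_ne_zero _) hval
  obtain ⟨𝔭, h𝔭⟩ := FieldPrime.exists_of_zpow V.valuation (g := (g : V.ValueGroup))
    (by rwa [← Units.val_one, Units.val_lt_val]) (V.valuation_surjective _) (fun y hy => by
      obtain ⟨n, hn⟩ := hgen (Units.mk0 (V.valuation y) ((Valuation.ne_zero_iff _).2 hy))
      exact ⟨n, by rw [← Units.val_zpow_eq_zpow_val, ← hn, Units.val_mk0]⟩)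
  exact ⟨𝔭, h𝔭 x hvx⟩

/-- An element of a function field over a finite field with neither zeros nor poles outside one
prime is algebraic over the constants. -/
theorem FieldPrime.isAlgebraic_of_forall_eq_zero {F K : Type*} [Field F] [Finite F] [Field K]
    [Algebra F K] [Algebra.EssFiniteType F K] (h1 : Algebra.trdeg F K ≤ 1)
    (infty : FieldPrime K) {x : K} (hx : ∀ 𝔭 : FieldPrime K, 𝔭 ≠ infty → 𝔭.v x = 0) :
    IsAlgebraic F x := by
  by_contra hn
  have hx0 : x ≠ 0 := fun h => hn (h ▸ isAlgebraic_zero)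
  obtain ⟨𝔭, h𝔭⟩ := FieldPrime.exists_pos_of_transcendental h1 hn
  obtain ⟨𝔮, h𝔮⟩ := FieldPrime.exists_pos_of_transcendental h1
    (x := x⁻¹) (fun h => hn (by simpa using h.inv))
  have hmul : ∀ 𝔯 : FieldPrime K, 𝔯.v x + 𝔯.v x⁻¹ = 0 := fun 𝔯 => by
    rw [← AddValuation.map_mul, mul_inv_cancel₀ hx0, AddValuation.map_one]
  have e1 : 𝔭 = infty := by
    by_contra h
    exact h𝔭.ne' (hx _ h)
  have e2 : 𝔮 = infty := by
    by_contra h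
    have := hmul 𝔮
    rw [hx _ h, zero_add] at this
    exact h𝔮.ne' this
  subst e1
  subst e2
  exact (h𝔭.trans_le (le_add_of_nonneg_right h𝔮.le)).ne' (hmul 𝔮)

/-! ### Binary forms and their zeros -/

namespace MvPolynomial

/-- The linear form `w₁ X - w₀ Y` vanishing at `w`. -/
noncomputable def vanishingForm {K : Type*} [Field K] (w : Fin 2 → K) : MvPolynomial (Fin 2) K :=
  C (w 1) * X 0 - C (w 0) * X 1

theorem eval_smul_of_isHomogeneous {K σ : Type*} [Field K] {d : ℕ} {H : MvPolynomial σ K}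
    (hH : H.IsHomogeneous d) (a : K) (x : σ → K) : eval (a • x) H = a ^ d * eval x H := by
  rw [eval_eq, eval_eq, Finset.mul_sum]
  refine Finset.sum_congr rfl fun m hm => ?_
  have hdeg : m.degree = d := by
    by_contra hne
    exact mem_support_iff.1 hm (hH.coeff_eq_zero hne)
  have hprod : (∏ i ∈ m.support, a ^ m i) = a ^ d := by
    rw [Finset.prod_pow_eq_pow_sum, ← hdeg]; rfl
  simp only [Pi.smul_apply, smul_eq_mul, mul_pow, Finset.prod_mul_distrib, hprod]
  ring

/-- Take a linear form `Z` with `Z(w) = 1`. Modulo `vanishingForm w` each variable `X i` is `w i *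
Z`, so `H` becomes `H(w) * Z ^ d`. -/
theorem vanishingForm_dvd {K : Type*} [Field K] {w : Fin 2 → K} (hw : w ≠ 0) {d : ℕ}
    {H : MvPolynomial (Fin 2) K} (hH : H.IsHomogeneous d) (h0 : eval w H = 0) :
    vanishingForm w ∣ H := by
  obtain ⟨c, hc⟩ : ∃ c : Fin 2 → K, c 0 * w 0 + c 1 * w 1 = 1 := by
    by_cases h0 : w 0 = 0
    · have h1 : w 1 ≠ 0 := fun h1 => hw (by ext i; fin_cases i <;> simp [h0, h1])
      exact ⟨![0, (w 1)⁻¹], by simp [h1]⟩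
    · exact ⟨![(w 0)⁻¹, 0], by simp [h0]⟩
  set Z : MvPolynomial (Fin 2) K := C (c 0) * X 0 + C (c 1) * X 1 with hZ
  have hcC : (C (c 0) * C (w 0) + C (c 1) * C (w 1) : MvPolynomial (Fin 2) K) = 1 := by
    rw [← C_mul, ← C_mul, ← C_add, hc, C_1]
  have hmod : ∀ i, vanishingForm w ∣ X i - C (w i) * Z := by
    intro i
    fin_cases i
    · exact ⟨C (c 1), by simp only [vanishingForm, hZ, Fin.zero_eta]; linear_combination (- X 0) * hcC⟩
    · exact ⟨- C (c 0), by simp only [vanishingForm, hZ, Fin.mk_one]; linear_combination (- X 1) * hcC⟩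
  let I := Ideal.span {vanishingForm w}
  have hcomp : (Ideal.Quotient.mkₐ K I)
      = (Ideal.Quotient.mkₐ K I).comp (aeval fun i => C (w i) * Z) := by
    apply MvPolynomial.algHom_ext
    intro i
    simp only [AlgHom.comp_apply, aeval_X, Ideal.Quotient.mkₐ_eq_mk]
    exact Ideal.Quotient.eq.2 (Ideal.mem_span_singleton.2 (hmod i))
  have hz : aeval (fun i => C (w i) * Z) H = 0 := by
    have : aeval (fun i => C (w i) * Z) H = C (eval w H) * Z ^ d := by
      rw [aeval_def, eval₂_eq, eval_eq, map_sum, Finset.sum_mul]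
      refine Finset.sum_congr rfl fun m hm => ?_
      have hdeg : m.degree = d := by
        by_contra hne
        exact mem_support_iff.1 hm (hH.coeff_eq_zero hne)
      have hprod : (∏ i ∈ m.support, Z ^ m i) = Z ^ d := by
        rw [Finset.prod_pow_eq_pow_sum, ← hdeg]; rfl
      simp only [mul_pow, Finset.prod_mul_distrib, hprod, map_mul, map_prod, map_pow,
        MvPolynomial.algebraMap_eq]
      ring
    rw [this, h0, C_0, zero_mul]
  have := DFunLike.congr_fun hcomp H
  rw [AlgHom.comp_apply, hz, map_zero, Ideal.Quotient.mkₐ_eq_mk,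
    Ideal.Quotient.eq_zero_iff_mem, Ideal.mem_span_singleton] at this
  exact this

/-- Both variables, multiplied by the determinant, are combinations of the two forms, so a common
divisor divides `X 0` and `X 1`. -/
theorem isRelPrime_vanishingForm {K : Type*} [Field K] {w z : Fin 2 → K}
    (h : w 0 * z 1 - z 0 * w 1 ≠ 0) : IsRelPrime (vanishingForm w) (vanishingForm z) := by
  intro D hw hz
  have hu : IsUnit (C (w 0 * z 1 - z 0 * w 1) : MvPolynomial (Fin 2) K) :=
    (isUnit_iff_ne_zero.2 h).map C
  have h0 : D ∣ X 0 := by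
    rw [← hu.dvd_mul_left]
    have := dvd_sub (hz.mul_left (C (w 0))) (hw.mul_left (C (z 0)))
    convert this using 1
    simp only [vanishingForm, C_sub, C_mul]
    ring
  have h1 : D ∣ X 1 := by
    rw [← hu.dvd_mul_left]
    have := dvd_sub (hz.mul_left (C (w 1))) (hw.mul_left (C (z 1)))
    convert this using 1
    simp only [vanishingForm, C_sub, C_mul]
    ring
  rcases (X_prime (R := K) (i := (0 : Fin 2))).irreducible.dvd_iff.1 h0 with hD | hD
  · exact hD
  · exact absurd (X_dvd_X.1 (hD.dvd.trans h1)) (by simp)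

theorem vanishingForm_ne_zero_and_totalDegree {K : Type*} [Field K] {w : Fin 2 → K} (hw : w ≠ 0) :
    vanishingForm w ≠ 0 ∧ (vanishingForm w).totalDegree = 1 := by
  have hne : vanishingForm w ≠ 0 := by
    intro h
    refine hw ?_
    ext i
    have h0 := congrArg (eval ![1, 0]) h
    have h1 := congrArg (eval ![0, 1]) h
    fin_cases i
    · simpa [vanishingForm] using h1
    · simpa [vanishingForm] using h0
  refine ⟨hne, IsHomogeneous.totalDegree ?_ hne⟩
  exact (isHomogeneous_C_mul_X _ _).sub (isHomogeneous_C_mul_X _ _)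

/-- A binary form of degree less than the number of its zeros vanishes. -/
theorem IsHomogeneous.eq_zero_of_card_lt {K ι : Type*} [Field K] {n : ℕ}
    {H : MvPolynomial (Fin 2) K} (hH : H.IsHomogeneous n) (s : Finset ι) (w : ι → Fin 2 → K)
    (hn : n < s.card) (hw : ∀ i ∈ s, w i ≠ 0)
    (hprop : ∀ i ∈ s, ∀ j ∈ s, i ≠ j → w i 0 * w j 1 - w j 0 * w i 1 ≠ 0)
    (h0 : ∀ i ∈ s, eval (w i) H = 0) : H = 0 := by
  classical
  by_contra hne
  -- The linear factors are pairwise coprime, so their product, of degree `s.card > n`, divides `H`.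
  have hdvd : ∏ i ∈ s, vanishingForm (w i) ∣ H :=
    Finset.prod_dvd_of_isRelPrime
      (fun i hi j hj hij => isRelPrime_vanishingForm (hprop i hi j hj hij))
      (fun i hi => vanishingForm_dvd (hw i hi) hH (h0 i hi))
  have hdeg : ∀ t ⊆ s, (∏ i ∈ t, vanishingForm (w i)).totalDegree = t.card := by
    intro t
    induction t using Finset.induction_on with
    | empty => simp
    | insert a t ha ih =>
      intro hts
      have h1 := vanishingForm_ne_zero_and_totalDegree (hw a (hts (Finset.mem_insert_self a t)))
      have ht : t ⊆ s := (Finset.subset_insert a t).trans hts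
      rw [Finset.prod_insert ha, totalDegree_mul_of_isDomain h1.1
        (Finset.prod_ne_zero_iff.2 fun i hi => (vanishingForm_ne_zero_and_totalDegree (hw i (ht hi))).1),
        h1.2, ih ht, Finset.card_insert_of_notMem ha, add_comm]
  obtain ⟨c, hc⟩ := hdvd
  have hc0 : c ≠ 0 := by rintro rfl; simp at hc; exact hne hc
  have hp0 : ∏ i ∈ s, vanishingForm (w i) ≠ 0 := by
    intro h; rw [h, zero_mul] at hc; exact hne hc
  have := hH.totalDegree hne
  rw [hc, totalDegree_mul_of_isDomain hp0 hc0, hdeg s subset_rfl] at this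
  omega

/-- Apply a linear functional to the coefficients of a polynomial. -/
noncomputable def mapFunctional {K σ : Type*} [Field K] {k : Subfield K} (l : K →ₗ[k] k)
    (H : MvPolynomial σ K) : MvPolynomial σ K :=
  ∑ m ∈ H.support, monomial m (l (coeff m H) : K)

theorem coeff_mapFunctional {K σ : Type*} [Field K] {k : Subfield K} (l : K →ₗ[k] k)
    (H : MvPolynomial σ K) (m : σ →₀ ℕ) : coeff m (mapFunctional l H) = (l (coeff m H) : K) := by
  classical
  rw [mapFunctional, coeff_sum]
  simp only [coeff_monomial, Finset.sum_ite_eq', mem_support_iff]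
  split_ifs with h
  · rfl
  · rw [not_not.1 h, map_zero, ZeroMemClass.coe_zero]

theorem isHomogeneous_mapFunctional {K σ : Type*} [Field K] {k : Subfield K} (l : K →ₗ[k] k)
    {H : MvPolynomial σ K} {d : ℕ} (hH : H.IsHomogeneous d) :
    (mapFunctional l H).IsHomogeneous d := by
  intro m hm
  rw [coeff_mapFunctional] at hm
  exact hH fun h => hm (by rw [h, map_zero, ZeroMemClass.coe_zero])

/-- At a point with coordinates in `k` the monomials take values in `k`, and `l` is `k`-linear. -/
theorem eval_mapFunctional {K σ : Type*} [Field K] {k : Subfield K} (l : K →ₗ[k] k)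
    (H : MvPolynomial σ K) {x : σ → K} (hx : ∀ i, x i ∈ k) :
    eval x (mapFunctional l H) = (l (eval x H) : K) := by
  rw [mapFunctional, map_sum, eval_eq, map_sum, AddSubmonoidClass.coe_finsetSum]
  refine Finset.sum_congr rfl fun m _ => ?_
  let a : k := ⟨∏ i ∈ m.support, x i ^ m i, prod_mem fun i _ => pow_mem (hx i) _⟩
  have e : coeff m H * ∏ i ∈ m.support, x i ^ m i = a • coeff m H := by
    rw [Subfield.smul_def, smul_eq_mul, mul_comm]
  rw [e, map_smul, eval_monomial, smul_eq_mul, MulMemClass.coe_mul, mul_comm]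
  rfl

end MvPolynomial

/-! ### Descent of a rational map to a subfield -/

namespace RationalMap

/-- If one coordinate were zero, coprimality would make the other a unit, but a form of positive
degree vanishes at the origin. -/
theorem F_ne_zero_and_G_ne_zero {K : Type*} [Field K] {d : ℕ} (φ : RationalMap K d) (hd : d ≠ 0) :
    φ.F ≠ 0 ∧ φ.G ≠ 0 := by
  have key : ∀ H : MvPolynomial (Fin 2) K, H.IsHomogeneous d → ¬ IsUnit H := fun H hH hu => by
    have h := eval_smul_of_isHomogeneous hH 0 0
    rw [zero_pow hd, zero_mul, zero_smul] at h
    exact (hu.map (eval (0 : Fin 2 → K))).ne_zero h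
  refine ⟨fun h => ?_, fun h => ?_⟩
  · exact key _ φ.homG (φ.relPrime (h ▸ dvd_zero _) dvd_rfl)
  · exact key _ φ.homF (φ.relPrime dvd_rfl (h ▸ dvd_zero _))

/-- A rational map of degree `d > 0` is determined up to a scalar by the ratio of its
coordinates. -/
theorem exists_C_mul_eq {K : Type*} [Field K] {d : ℕ} (φ : RationalMap K d) (hd : d ≠ 0)
    {F' G' : MvPolynomial (Fin 2) K} (hF : F'.IsHomogeneous d)
    (h : φ.F * G' = F' * φ.G) : ∃ c : K, F' = C c * φ.F ∧ G' = C c * φ.G := by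
  obtain ⟨hF0, hG0⟩ := φ.F_ne_zero_and_G_ne_zero hd
  -- Coprimality gives divisibility; equality of degrees then makes the cofactor constant.
  obtain ⟨c, rfl⟩ : φ.F ∣ F' := φ.relPrime.dvd_of_dvd_mul_right ⟨G', h.symm⟩
  have hG' : G' = c * φ.G := mul_left_cancel₀ hF0 (by rw [h, mul_assoc])
  by_cases hc : c = 0
  · exact ⟨0, by simp [hc], by simp [hG', hc]⟩
  have h1 := hF.totalDegree (mul_ne_zero hF0 hc)
  rw [totalDegree_mul_of_isDomain hF0 hc, φ.homF.totalDegree hF0] at h1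
  have h2 : c = C (coeff 0 c) := totalDegree_eq_zero_iff_eq_C.1 (by omega)
  exact ⟨coeff 0 c, by rw [← h2, mul_comm], by rw [← h2, hG']⟩

/-- A rational map of degree `d` sending `2 d + 1` points with coordinates in `k` to points with
coordinates in `k` is defined over `k`. -/
theorem isDefinedOver_of_card_lt {K ι : Type*} [Field K] {d : ℕ} (φ : RationalMap K d)
    (hd : d ≠ 0) (k : Subfield K) (s : Finset ι) (w z : ι → Fin 2 → K) (hs : 2 * d < s.card)
    (hw : ∀ i ∈ s, w i ≠ 0) (hz : ∀ i ∈ s, z i ≠ 0)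
    (hwk : ∀ i ∈ s, ∀ a, w i a ∈ k) (hzk : ∀ i ∈ s, ∀ a, z i a ∈ k)
    (hprop : ∀ i ∈ s, ∀ j ∈ s, i ≠ j → w i 0 * w j 1 - w j 0 * w i 1 ≠ 0)
    (hφ : ∀ i ∈ s, eval (w i) φ.F * z i 1 = eval (w i) φ.G * z i 0) : φ.IsDefinedOver k := by
  obtain ⟨hF0, -⟩ := φ.F_ne_zero_and_G_ne_zero hd
  obtain ⟨m, hm⟩ := ne_zero_iff.1 hF0
  -- Being nonzero on one coefficient of `F` will keep the final scalar `c` from vanishing.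
  obtain ⟨l, hl⟩ : ∃ l : K →ₗ[k] k, l (coeff m φ.F) ≠ 0 := by
    by_contra! hcon
    exact hm ((Module.forall_dual_apply_eq_zero_iff k _).1 hcon)
  have heq : φ.F * mapFunctional l φ.G = mapFunctional l φ.F * φ.G := by
    rw [← sub_eq_zero]
    have hhom : (φ.F * mapFunctional l φ.G - mapFunctional l φ.F * φ.G).IsHomogeneous (d + d) :=
      (φ.homF.mul (isHomogeneous_mapFunctional l φ.homG)).sub
        ((isHomogeneous_mapFunctional l φ.homF).mul φ.homG)
    refine hhom.eq_zero_of_card_lt s w (by omega) hw hprop fun i hi => ?_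
    rw [map_sub, map_mul, map_mul, eval_mapFunctional l _ (hwk i hi),
      eval_mapFunctional l _ (hwk i hi)]
    have h1 := hφ i hi
    -- The condition that the value is `z i` is linear over `k`, so it survives `l`; both pairs then
    -- represent the same point.
    have h2 : (l (eval (w i) φ.F) : K) * z i 1 = (l (eval (w i) φ.G) : K) * z i 0 := by
      have e : (⟨z i 1, hzk i hi 1⟩ : k) • eval (w i) φ.F
          = (⟨z i 0, hzk i hi 0⟩ : k) • eval (w i) φ.G := by
        rw [Subfield.smul_def, Subfield.smul_def, smul_eq_mul, smul_eq_mul, mul_comm, h1, mul_comm]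
      have := congrArg (fun x => (l x : K)) e
      simp only [map_smul, smul_eq_mul, MulMemClass.coe_mul] at this
      rw [mul_comm, this, mul_comm]
    have hzi : z i 0 ≠ 0 ∨ z i 1 ≠ 0 := by
      by_contra! hcon
      exact hz i hi (funext fun a => by fin_cases a; exacts [hcon.1, hcon.2])
    rcases hzi with h | h
    · apply mul_left_cancel₀ h
      linear_combination (eval (w i)) φ.F * -h2 + (l (eval (w i) φ.F) : K) * h1
    · apply mul_left_cancel₀ h
      linear_combination (l (eval (w i) φ.G) : K) * h1 - (eval (w i) φ.G) * h2
  obtain ⟨c, h1, h2⟩ := φ.exists_C_mul_eq hd (isHomogeneous_mapFunctional l φ.homF) heq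
  have e1 : ∀ m, c * coeff m φ.F = (l (coeff m φ.F) : K) := fun m => by
    rw [← coeff_mapFunctional, h1, coeff_C_mul]
  have e2 : ∀ m, c * coeff m φ.G = (l (coeff m φ.G) : K) := fun m => by
    rw [← coeff_mapFunctional, h2, coeff_C_mul]
  refine ⟨c, fun hc => hl ?_, fun m => ?_⟩
  · have := e1 m
    rw [hc, zero_mul] at this
    exact Subtype.ext this.symm
  · rw [e1, e2]
    exact ⟨SetLike.coe_mem _, SetLike.coe_mem _⟩

end RationalMap

/-! ### Cross-ratios and algebraic coordinates -/

theorem Projectivization.mk_eq_mk_iff_det {K : Type*} [Field K] {x y : Fin 2 → K}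
    (hx : x ≠ 0) (hy : y ≠ 0) :
    Projectivization.mk K x hx = Projectivization.mk K y hy ↔ x 0 * y 1 - y 0 * x 1 = 0 := by
  rw [Projectivization.mk_eq_mk_iff']
  constructor
  · rintro ⟨a, rfl⟩
    simp only [Pi.smul_apply, smul_eq_mul]
    ring
  · intro h
    by_cases h0 : y 0 = 0
    · have h1 : y 1 ≠ 0 := fun h1 => hy (by ext i; fin_cases i <;> simp [h0, h1])
      refine ⟨x 1 / y 1, ?_⟩
      have : x 0 = 0 := by simpa [h0, h1] using h
      ext i
      fin_cases i
      · simp [h0, this]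
      · simp [h1]
    · refine ⟨x 0 / y 0, ?_⟩
      ext i
      fin_cases i
      · simp [h0]
      · simp only [Fin.mk_one, Pi.smul_apply, smul_eq_mul]
        field_simp
        linear_combination h

/-- If four logarithmic distances agree, so do the two products of determinants entering the
cross-ratio. -/
theorem val_det_add_eq {K : Type*} [Field K] (𝔭 : FieldPrime K) {c : WithTop ℤ}
    {x y z t : Fin 2 → K} (hx : x ≠ 0) (hy : y ≠ 0) (hz : z ≠ 0) (ht : t ≠ 0)
    (hxz : logDist 𝔭 (.mk K x hx) (.mk K z hz) = c) (hxt : logDist 𝔭 (.mk K x hx) (.mk K t ht) = c)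
    (hyz : logDist 𝔭 (.mk K y hy) (.mk K z hz) = c)
    (hyt : logDist 𝔭 (.mk K y hy) (.mk K t ht) = c) :
    𝔭.v (x 0 * z 1 - z 0 * x 1) + 𝔭.v (y 0 * t 1 - t 0 * y 1) =
      𝔭.v (x 0 * t 1 - t 0 * x 1) + 𝔭.v (y 0 * z 1 - z 0 * y 1) := by
  have key : ∀ z : Fin 2 → K, z ≠ 0 → ∃ m : ℤ, min (𝔭.v (z 0)) (𝔭.v (z 1)) = (m : WithTop ℤ) := by
    intro z hz
    have : min (𝔭.v (z 0)) (𝔭.v (z 1)) ≠ ⊤ := by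
      intro h
      rw [min_eq_top, AddValuation.top_iff, AddValuation.top_iff] at h
      exact hz (by ext i; fin_cases i <;> simp [h.1, h.2])
    exact ⟨_, (WithTop.coe_untop _ this).symm⟩
  have solve : ∀ (a : WithTop ℤ) (m n : ℤ), a - m - n = c → a = c + m + n := by
    rintro a m n rfl
    cases a with
    | top => rfl
    | coe a => norm_cast; ring
  obtain ⟨mx, hmx⟩ := key x hx
  obtain ⟨my, hmy⟩ := key y hy
  obtain ⟨mz, hmz⟩ := key z hz
  obtain ⟨mt, hmt⟩ := key t ht
  rw [logDist_mk, hmx, hmz] at hxz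
  rw [logDist_mk, hmx, hmt] at hxt
  rw [logDist_mk, hmy, hmz] at hyz
  rw [logDist_mk, hmy, hmt] at hyt
  -- Each side becomes `c + c` plus the same four minima.
  rw [solve _ _ _ hxz, solve _ _ _ hxt, solve _ _ _ hyz, solve _ _ _ hyt]
  abel

theorem FieldPrime.val_eq_zero_of_val_eq {K : Type*} [Field K] (𝔭 : FieldPrime K) {a b : K}
    (hb : b ≠ 0) (h : 𝔭.v a = 𝔭.v b) : 𝔭.v (a / b) = 0 := by
  have h1 : 𝔭.v (a / b) + 𝔭.v b = 𝔭.v b := by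
    rw [← AddValuation.map_mul, div_mul_cancel₀ a hb, h]
  rw [← WithTop.coe_untop _ ((AddValuation.ne_top_iff 𝔭.v).2 hb)] at h1
  exact WithTop.add_right_cancel (WithTop.coe_ne_top) (h1.trans (zero_add _).symm)

/-- In suitable coordinates, a set of points at constant logarithmic distances outside one prime
consists of points whose coordinates are algebraic over the constants. -/
theorem exists_algebraic_coordinates {F K : Type*} [Field F] [Finite F] [Field K]
    [Algebra F K] [Algebra.EssFiniteType F K] (h1 : Algebra.trdeg F K ≤ 1)
    (infty : FieldPrime K) (A : Set (ℙ K (Fin 2 → K)))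
    (ha : ∀ 𝔭 : FieldPrime K, 𝔭 ≠ infty →
      ∃ c : WithTop ℤ, ∀ P ∈ A, ∀ Q ∈ A, P ≠ Q → logDist 𝔭 P Q = c)
    {P₁ P₂ P₃ : ℙ K (Fin 2 → K)} (hP₁ : P₁ ∈ A) (hP₂ : P₂ ∈ A) (hP₃ : P₃ ∈ A)
    (h₁₂ : P₁ ≠ P₂) (h₁₃ : P₁ ≠ P₃) (h₂₃ : P₂ ≠ P₃) :
    ∃ M : GL (Fin 2) K, ∀ Q ∈ A, ∃ w : Fin 2 → K, (∀ i, IsAlgebraic F (w i)) ∧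
      ∃ hw : M.1.mulVec w ≠ 0, Q = .mk K (M.1.mulVec w) hw := by
  obtain ⟨u₁, hu₁, rfl⟩ : ∃ u, ∃ hu : u ≠ 0, P₁ = .mk K u hu := ⟨_, P₁.rep_nonzero, P₁.mk_rep.symm⟩
  obtain ⟨u₂, hu₂, rfl⟩ : ∃ u, ∃ hu : u ≠ 0, P₂ = .mk K u hu := ⟨_, P₂.rep_nonzero, P₂.mk_rep.symm⟩
  obtain ⟨u₃, hu₃, rfl⟩ : ∃ u, ∃ hu : u ≠ 0, P₃ = .mk K u hu := ⟨_, P₃.rep_nonzero, P₃.mk_rep.symm⟩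
  rw [Ne, Projectivization.mk_eq_mk_iff_det] at h₁₂ h₁₃ h₂₃
  set α := (u₃ 0 * u₂ 1 - u₂ 0 * u₃ 1) / (u₁ 0 * u₂ 1 - u₂ 0 * u₁ 1) with hα
  set β := (u₁ 0 * u₃ 1 - u₃ 0 * u₁ 1) / (u₁ 0 * u₂ 1 - u₂ 0 * u₁ 1) with hβ
  have hα0 : α ≠ 0 := div_ne_zero (fun h => h₂₃ (by linear_combination -h)) h₁₂
  have hβ0 : β ≠ 0 := div_ne_zero h₁₃ h₁₂
  have hD : (α * u₁ 0) * (β * u₂ 1) - (β * u₂ 0) * (α * u₁ 1) ≠ 0 := by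
    have := mul_ne_zero (mul_ne_zero hα0 hβ0) h₁₂
    intro h
    exact this (by linear_combination h)
  -- Cramer's rule. The matrix with columns `α u₁`, `β u₂` therefore sends `[1:0]`, `[0:1]`, `[1:1]`
  -- to the three chosen points.
  have hu₃' : ∀ i, u₃ i = α * u₁ i + β * u₂ i := by
    intro i
    have hαD : α * _ = _ := div_mul_cancel₀ _ h₁₂
    have hβD : β * _ = _ := div_mul_cancel₀ _ h₁₂
    apply mul_right_cancel₀ h₁₂
    fin_cases i
    · simp only [Fin.zero_eta]
      linear_combination -(u₁ 0) * hαD - u₂ 0 * hβD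
    · simp only [Fin.mk_one]
      linear_combination -(u₁ 1) * hαD - u₂ 1 * hβD
  let M : Matrix (Fin 2) (Fin 2) K := !![α * u₁ 0, β * u₂ 0; α * u₁ 1, β * u₂ 1]
  have hM : M.det ≠ 0 := by rw [Matrix.det_fin_two_of]; exact hD
  refine ⟨Matrix.GeneralLinearGroup.mkOfDetNeZero M hM, ?_⟩
  change ∀ Q ∈ A, ∃ w : Fin 2 → K, (∀ i, IsAlgebraic F (w i)) ∧
      ∃ hw : M.mulVec w ≠ 0, Q = .mk K (M.mulVec w) hw
  have hmul : ∀ w, w ≠ 0 → M.mulVec w ≠ 0 := fun w hw h =>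
    hw (Matrix.eq_zero_of_mulVec_eq_zero hM h)
  have hM0 : ∀ w, M.mulVec w 0 = α * u₁ 0 * w 0 + β * u₂ 0 * w 1 := fun w => by
    simp [M, Matrix.mulVec, dotProduct, Fin.sum_univ_two]
  have hM1 : ∀ w, M.mulVec w 1 = α * u₁ 1 * w 0 + β * u₂ 1 * w 1 := fun w => by
    simp [M, Matrix.mulVec, dotProduct, Fin.sum_univ_two]
  intro Q hQ
  obtain ⟨x, hx, rfl⟩ : ∃ u, ∃ hu : u ≠ 0, Q = .mk K u hu := ⟨_, Q.rep_nonzero, Q.mk_rep.symm⟩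
  by_cases hQ₁ : x 0 * u₁ 1 - u₁ 0 * x 1 = 0
  · refine ⟨![1, 0], fun i => ?_, hmul _ (by simp), ?_⟩
    · fin_cases i
      exacts [isAlgebraic_one, isAlgebraic_zero]
    · rw [Projectivization.mk_eq_mk_iff_det, hM0, hM1]
      simp only [Matrix.cons_val_zero, Matrix.cons_val_one]
      linear_combination α * hQ₁
  by_cases hQ₂ : x 0 * u₂ 1 - u₂ 0 * x 1 = 0
  · refine ⟨![0, 1], fun i => ?_, hmul _ (by simp), ?_⟩
    · fin_cases i
      exacts [isAlgebraic_zero, isAlgebraic_one]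
    · rw [Projectivization.mk_eq_mk_iff_det, hM0, hM1]
      simp only [Matrix.cons_val_zero, Matrix.cons_val_one]
      linear_combination β * hQ₂
  -- By Cramer's rule `[a : b]` are the new coordinates of `Q`, and `a / b` is a cross-ratio of `Q,
  -- P₃` with `P₁, P₂`. The distance from `Q` to `P₃` does not enter, so `Q = P₃` needs no separate
  -- case.
  set a := β * (x 0 * u₂ 1 - u₂ 0 * x 1) with ha'
  set b := -(α * (x 0 * u₁ 1 - u₁ 0 * x 1)) with hb'
  have hb0 : b ≠ 0 := neg_ne_zero.2 (mul_ne_zero hα0 hQ₁)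
  refine ⟨![a / b, 1], fun i => ?_, hmul _ (by simp), ?_⟩
  · fin_cases i
    · refine FieldPrime.isAlgebraic_of_forall_eq_zero h1 infty fun 𝔭 h𝔭 => ?_
      apply 𝔭.val_eq_zero_of_val_eq hb0
      obtain ⟨c, hc⟩ := ha 𝔭 h𝔭
      have hne : ∀ {y z : Fin 2 → K} (hy : y ≠ 0) (hz : z ≠ 0), y 0 * z 1 - z 0 * y 1 ≠ 0 →
          Projectivization.mk K y hy ≠ .mk K z hz := fun hy hz h =>
        (Projectivization.mk_eq_mk_iff_det hy hz).not.2 h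
      have key := val_det_add_eq 𝔭 hx hu₃ hu₂ hu₁
        (hc _ hQ _ hP₂ (hne hx hu₂ hQ₂)) (hc _ hQ _ hP₁ (hne hx hu₁ hQ₁))
        (hc _ hP₃ _ hP₂ (hne hu₃ hu₂ fun h => h₂₃ (by linear_combination -h)))
        (hc _ hP₃ _ hP₁ (hne hu₃ hu₁ fun h => h₁₃ (by linear_combination -h)))
      have e1 : u₃ 0 * u₁ 1 - u₁ 0 * u₃ 1 = -(β * (u₁ 0 * u₂ 1 - u₂ 0 * u₁ 1)) := by
        rw [hu₃' 0, hu₃' 1]; ring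
      have e2 : u₃ 0 * u₂ 1 - u₂ 0 * u₃ 1 = α * (u₁ 0 * u₂ 1 - u₂ 0 * u₁ 1) := by
        rw [hu₃' 0, hu₃' 1]; ring
      rw [e1, e2, AddValuation.map_neg, AddValuation.map_mul, AddValuation.map_mul,
        ← add_assoc, ← add_assoc] at key
      have key2 := WithTop.add_right_cancel ((AddValuation.ne_top_iff 𝔭.v).2 h₁₂) key
      rw [ha', hb', AddValuation.map_neg, AddValuation.map_mul, AddValuation.map_mul,
        add_comm, key2, add_comm]
    · exact isAlgebraic_one
  · rw [Projectivization.mk_eq_mk_iff_det, hM0, hM1]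
    simp only [Matrix.cons_val_zero, Matrix.cons_val_one]
    field_simp
    rw [ha', hb']
    ring

/-! ### Conjugation and the main theorem -/

namespace RationalMap

theorem eval_linSubst {K : Type*} [Field K] (B : Matrix (Fin 2) (Fin 2) K) (w : Fin 2 → K)
    (H : MvPolynomial (Fin 2) K) : eval w (linSubst B H) = eval (B.mulVec w) H := by
  have : (aeval w).comp (linSubst B) = (aeval (B.mulVec w) : _ →ₐ[K] K) := by
    apply MvPolynomial.algHom_ext
    intro i
    rw [AlgHom.comp_apply, linSubst, aeval_X, aeval_X]
    simp [linForm, Matrix.mulVec, dotProduct, Fin.sum_univ_two]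
  have h := DFunLike.congr_fun this H
  simpa only [AlgHom.comp_apply, aeval_eq_eval] using h

theorem eval_conj {K : Type*} [Field K] {d : ℕ} (φ : RationalMap K d) (μ : GL (Fin 2) K)
    (w : Fin 2 → K) : ![eval w (φ.conj μ).F, eval w (φ.conj μ).G] =
      μ.1.mulVec ![eval (μ⁻¹.1.mulVec w) φ.F, eval (μ⁻¹.1.mulVec w) φ.G] := by
  ext i
  fin_cases i <;>
    simp [conj, eval_linSubst, Matrix.mulVec, dotProduct, Fin.sum_univ_two]

/-- A constant map is conjugate to the constant map `[1 : 0]`. -/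
theorem exists_conj_isDefinedOver_of_degree_zero {K : Type*} [Field K] (φ : RationalMap K 0)
    (k : Subfield K) : ∃ μ : GL (Fin 2) K, (φ.conj μ).IsDefinedOver k := by
  have hF : φ.F = C (coeff 0 φ.F) :=
    totalDegree_eq_zero_iff_eq_C.1 ((totalDegree_zero_iff_isHomogeneous _).2 φ.homF)
  have hG : φ.G = C (coeff 0 φ.G) :=
    totalDegree_eq_zero_iff_eq_C.1 ((totalDegree_zero_iff_isHomogeneous _).2 φ.homG)
  set a := coeff 0 φ.F
  set b := coeff 0 φ.G
  have hlin : ∀ (B : Matrix (Fin 2) (Fin 2) K) (c : K), linSubst B (C c) = C c := fun B c => by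
    rw [linSubst, aeval_C, MvPolynomial.algebraMap_eq]
  -- Substitution fixes constants, so conjugation by `M` just applies `M` to the value `(a, b)`; it
  -- suffices to send this vector to `(1, 0)`.
  have key : ∀ M : Matrix (Fin 2) (Fin 2) K, M.det ≠ 0 → M 0 0 * a + M 0 1 * b = 1 →
      M 1 0 * a + M 1 1 * b = 0 → ∃ μ : GL (Fin 2) K, (φ.conj μ).IsDefinedOver k := by
    intro M hM h0 h1
    refine ⟨Matrix.GeneralLinearGroup.mkOfDetNeZero M hM, 1, one_ne_zero, fun m => ?_⟩
    have e0 : (φ.conj (Matrix.GeneralLinearGroup.mkOfDetNeZero M hM)).F = C 1 := by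
      change C (M 0 0) * linSubst _ φ.F + C (M 0 1) * linSubst _ φ.G = _
      rw [← h0, hF, hG, hlin, hlin, C_add, C_mul, C_mul]
    have e1 : (φ.conj (Matrix.GeneralLinearGroup.mkOfDetNeZero M hM)).G = C 0 := by
      change C (M 1 0) * linSubst _ φ.F + C (M 1 1) * linSubst _ φ.G = _
      rw [← h1, hF, hG, hlin, hlin, C_add, C_mul, C_mul]
    classical
    rw [e0, e1, coeff_C, coeff_C, one_mul, one_mul]
    constructor <;> split_ifs
    exacts [one_mem k, zero_mem k, zero_mem k, zero_mem k]
  by_cases ha : a = 0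
  · have hb : b ≠ 0 := by
      intro hb
      have hu := φ.relPrime (d := 0) (by rw [hF, ha, C_0]) (by rw [hG, hb, C_0])
      exact not_isUnit_zero hu
    exact key !![0, b⁻¹; -b, 0] (by simp [Matrix.det_fin_two_of, hb]) (by simp [hb]) (by simp [ha])
  · exact key !![a⁻¹, 0; -b, a] (by simp [Matrix.det_fin_two_of, ha]) (by simp [ha])
      (by simp; ring)

end RationalMap

theorem mainTheorem4 {Fq K : Type*} [Field Fq] [Finite Fq] [Field K] [Algebra Fq⟮X⟯ K]
    [FunctionField Fq K] (infty : FieldPrime K) (d : ℕ) (φ : RationalMap K d)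
    (A A' : Set (ℙ K (Fin 2 → K)))
    (ha : ∀ 𝔭 : FieldPrime K, 𝔭 ≠ infty →
      ∃ c : WithTop ℤ, ∀ P ∈ A, ∀ Q ∈ A, P ≠ Q → logDist 𝔭 P Q = c)
    (hb : A' ∪ φ.toFun '' A' ⊆ A) :
    A'.encard ≤ 2 * d ∨
      ∃ (μ : GL (Fin 2) K) (k : Subfield K), Finite k ∧ (φ.conj μ).IsDefinedOver k := by
  let _ : Algebra Fq K := ((algebraMap Fq⟮X⟯ K).comp (algebraMap Fq Fq⟮X⟯)).toAlgebra
  have : IsScalarTower Fq Fq⟮X⟯ K := IsScalarTower.of_algebraMap_eq fun _ => rfl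
  have := FunctionField.essFiniteType Fq K
  have h1 := FunctionField.trdeg_le_one Fq K
  -- For `d = 0` the count `2d + 1 = 1` does not provide the three points needed for coordinates.
  rcases Nat.eq_zero_or_pos d with rfl | hd
  · obtain ⟨μ, hμ⟩ := φ.exists_conj_isDefinedOver_of_degree_zero (algebraMap Fq K).fieldRange
    exact Or.inr ⟨μ, _, (Set.finite_range (algebraMap Fq K)).to_subtype, hμ⟩
  refine or_iff_not_imp_left.2 fun hcard => ?_
  rw [not_le] at hcard
  obtain ⟨T, hTA, hT⟩ := Set.exists_subset_encard_eq (Order.add_one_le_of_lt hcard)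
  have hTfin : T.Finite := Set.finite_of_encard_eq_coe (k := 2 * d + 1) (by rw [hT]; norm_cast)
  obtain ⟨s, rfl⟩ := hTfin.exists_finset_coe
  have hs : s.card = 2 * d + 1 := by
    rw [Set.encard_coe_eq_coe_finsetCard] at hT
    exact_mod_cast hT
  have hsA : ∀ P ∈ s, P ∈ A := fun P hP => hb (Or.inl (hTA hP))
  have hφA : ∀ P ∈ s, φ.toFun P ∈ A := fun P hP => hb (Or.inr ⟨P, hTA hP, rfl⟩)
  obtain ⟨P₁, hP₁, P₂, hP₂, P₃, hP₃, h₁₂, h₁₃, h₂₃⟩ :=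
    Finset.two_lt_card.1 (show 2 < s.card by omega)
  obtain ⟨M, hM⟩ := exists_algebraic_coordinates h1 infty A ha (hsA _ hP₁) (hsA _ hP₂) (hsA _ hP₃)
    h₁₂ h₁₃ h₂₃
  choose! w hwalg hw0 hwmk using hM
  -- Finitely many elements algebraic over a finite field generate a finite field.
  let S : Set K := (⋃ P ∈ s, Set.range (w P)) ∪ ⋃ P ∈ s, Set.range (w (φ.toFun P))
  have hSfin : S.Finite := (s.finite_toSet.biUnion fun P _ => Set.finite_range _).union
    (s.finite_toSet.biUnion fun P _ => Set.finite_range _)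
  have hSalg : ∀ x ∈ S, IsIntegral Fq x := by
    intro x hx
    simp only [S, Set.mem_union, Set.mem_iUnion, Set.mem_range] at hx
    rcases hx with ⟨P, hP, i, rfl⟩ | ⟨P, hP, i, rfl⟩
    · exact (hwalg P (hsA P hP) i).isIntegral
    · exact (hwalg _ (hφA P hP) i).isIntegral
  have := hSfin.to_subtype
  have := IntermediateField.finiteDimensional_adjoin hSalg
  have hfin : Finite (IntermediateField.adjoin Fq S) := Module.finite_of_finite Fq
  have hwne : ∀ P ∈ A, w P ≠ 0 := fun P hP h => hw0 P hP (by rw [h, Matrix.mulVec_zero])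
  -- `M` carries the algebraic coordinates to the original ones, so the change of coordinates is
  -- `M⁻¹`.
  refine ⟨M⁻¹, (IntermediateField.adjoin Fq S).toSubfield, hfin, ?_⟩
  refine (φ.conj M⁻¹).isDefinedOver_of_card_lt hd.ne' _ s w (fun P => w (φ.toFun P)) (by omega)
    (fun P hP => hwne P (hsA P hP)) (fun P hP => hwne _ (hφA P hP)) (fun P hP i => ?_)
    (fun P hP i => ?_) (fun P hP Q hQ hPQ hdet => hPQ ?_) (fun P hP => ?_)
  · exact IntermediateField.subset_adjoin Fq S (Or.inl (Set.mem_biUnion hP ⟨i, rfl⟩))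
  · exact IntermediateField.subset_adjoin Fq S (Or.inr (Set.mem_biUnion hP ⟨i, rfl⟩))
  · rw [hwmk P (hsA P hP), hwmk Q (hsA Q hQ), Projectivization.mk_eq_mk_iff_det]
    simp only [Matrix.mulVec, dotProduct, Fin.sum_univ_two]
    linear_combination (M.1 0 0 * M.1 1 1 - M.1 0 1 * M.1 1 0) * hdet
  · have h2 : φ.toFun P = .mk K _ (φ.eval_ne_zero (hw0 P (hsA P hP))) :=
      (congrArg φ.toFun (hwmk P (hsA P hP))).trans (φ.toFun_mk _ _)
    have h3 := h2.symm.trans (hwmk _ (hφA P hP))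
    obtain ⟨c, hc⟩ := (Projectivization.mk_eq_mk_iff' K _ _ _ _).1 h3
    have h4 := φ.eval_conj M⁻¹ (w P)
    rw [inv_inv, ← hc, Matrix.mulVec_smul, Matrix.mulVec_mulVec,
      show M⁻¹.1 * M.1 = 1 from M.inv_val, Matrix.one_mulVec] at h4
    have e0 := congrFun h4 0
    have e1 := congrFun h4 1
    simp only [Matrix.cons_val_zero, Matrix.cons_val_one, Pi.smul_apply, smul_eq_mul] at e0 e1
    rw [e0, e1]
    ring
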